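/- **Setting.** Let $X$ be a real reflexive Banach space with a topological direct sum decomposition $X=X^+\oplus\tilde X$, $\tilde X=X^0\oplus X^1$, where $X^0,X^1$ are closed, $X^+$ and $X^0$ are Hilbert spaces in the norm of $X$, and $\|u\|^2=\|u^+\|^2+\|\tilde u\|^2$ for $u=u^++\tilde u$, $u^+\in X^+$, $\tilde u\in\tilde X$; write $\tilde u=u^0+u^1$ with $u^0\in X^0$, $u^1\in X^1$. Let $J,J_{cp}\in\mathcal C^1(X,\mathbb R)$ be of the form $$J(u)=\tfrac12\|u^+\|^2-I(u),\qquad J_{cp}(u)=\tfrac12\|u^++u^0\|^2-I_{cp}(u),$$ and put $$\mathcal N=\{u\in X\setminus\tilde X: J'(u)|_{\mathbb Ru\oplus\tilde X}=0\},\qquad \mathcal N_{cp}=\{u\in X\setminus X^1: J_{cp}'(u)|_{\mathbb Ru\oplus X^1}=0\},$$ $$c=\inf_{\mathcal N}J,\qquad d=\inf_{\mathcal N_{cp}}J_{cp}.$$ Write $u_n\xrightarrow{\mathcal T}u$ if $u_n^+\to u^+$ in norm and $\tilde u_n\rightharpoonup\tilde u$ weakly. **Conditions (A1)–(A4), (B1)–(B3)**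 for $J$: - (A1) $I\in\mathcal C^1(X,\mathbb R)$ and $I(u)\ge I(0)=0$ for all $u\in X$. - (A2) If $u_n\xrightarrow{\mathcal T}u$, then $\liminf I(u_n)\ge I(u)$. - (A3) If $u_n\xrightarrow{\mathcal T}u$ and $I(u_n)\to I(u)$, then $u_n\to u$. - (A4) There is $r>0$ with $\inf\{J(u):u\in X^+,\ \|u\|=r\}>0$. - (B1) $\|u^+\|+I(u)\to\infty$ as $\|u\|\to\infty$. - (B2) $I(t_nu_n)/t_n^2\to\infty$ if $t_n\to\infty$ and $u_n^+\to u^+$ for some $u^+\ne0$. - (B3) $\frac{t^2-1}{2}I'(u)(u)+tI'(u)(v)+I(u)-I(tu+v)<0$ for all $u\in\mathcal N$, $t\ge0$, $v\in\tilde X$ with $u\ne tu+v$. The conditions for $J_{cp}$ are the same with $X^+,\tilde X,I,J,\mathcal N$ replaced by $X^+\oplus X^0,X^1,I_{cp},J_{cp},\mathcal N_{cp}$. **Conditions (C1)–(C3):** - (C1) $J_{cp}(u_n)-J(u_n)\to0$ for every bounded sequence $(u_n)\subset\mathcal N_{cp}$ with $u_n^++u_n^0\rightharpoonup0$ weakly;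 moreover there is $M>0$ such that $J_{cp}(u)-J(u)\le M\|u^++u^0\|^2$ for all $u\in\mathcal N_{cp}$. - (C2) $I(t_nu_n)/t_n^2\to\infty$ if $t_n\to\infty$ and, for every $t>1$, the sequence $(I(tu_n^+))_n$ is bounded away from $0$. - (C3) If $(u_n)\subset\mathcal N$ and $u_n\rightharpoonup u$ in $X$, then $J'(u_n)(w)\to J'(u)(w)$ for every $w\in X$; if moreover $u\in\mathcal N$, then $\liminf J(u_n)\ge J(u)$. **Statement.** Assume that $J$ and $J_{cp}$ satisfy (A1)–(A4), (B1)–(B3), that $J$ is coercive on $\mathcal N$ (i.e. $J(u)\to\infty$ as $\|u\|\to\infty$, $u\in\mathcal N$) and $J_{cp}$ is coercive on $\mathcal N_{cp}$, and that (C1)–(C3) hold. If $X^0=\{0\}$, if $d$ is attained by a critical point of $J_{cp}$ (there is $u_0\in\mathcal N_{cp}$ with $J_{cp}(u_0)=d$ and $J_{cp}'(u_0)=0$), and if $J(u)<J_{cp}(u)$ for every $u\in\mathcal N$, then $c<d$, and $c$ is attained by a critical point of $J$: there is $u\in\mathcal N$ with $J(u)=c$ and $J'(u)=0$. -/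

import Mathlib

open Filter Topology Bornology

namespace NehariPankov

noncomputable section

section Basic

variable {X : Type*} [NormedAddCommGroup X] [NormedSpace ℝ X]

/-- A subspace of a normed space is a Hilbert space (for the norm of the ambient space): it is
complete and its norm comes from a scalar product. -/
def IsHilbert (V : Submodule ℝ X) : Prop :=
  IsComplete (V : Set X) ∧
    ∃ B : LinearMap.BilinForm ℝ V, B.IsSymm ∧ ∀ u : V, B u u = ‖(u : X)‖ ^ 2

/-- Weak convergence `u n ⇀ x` of a sequence. -/
def WeakTendsto (u : ℕ → X) (x : X) : Prop :=
  ∀ f : StrongDual ℝ X, Tendsto (fun n => f (u n)) atTop (𝓝 (f x))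

/-- The infimum of a real function over a set, taken in the extended reals. -/
def infOn (J : X → ℝ) (N : Set X) : EReal := ⨅ u ∈ N, (J u : EReal)

/-- `J u → ∞` as `‖u‖ → ∞`, `u ∈ N`. -/
def CoerciveOn (J : X → ℝ) (N : Set X) : Prop :=
  Tendsto J (cobounded X ⊓ 𝓟 N) atTop

end Basic

variable (X : Type*) [NormedAddCommGroup X] [NormedSpace ℝ X]

/-- The normed space `X` is reflexive: the canonical isometry into its bidual is onto. -/
def IsReflexiveSpace : Prop :=
  Function.Surjective (NormedSpace.inclusionInDoubleDual ℝ X)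

/-- An ordered direct sum decomposition `X = plus ⊕ tilde` into two subspaces. -/
structure Splitting where
  plus : Submodule ℝ X
  tilde : Submodule ℝ X
  isCompl : IsCompl plus tilde

/-- The topological direct sum decompositions `X = X⁺ ⊕ X̃`, `X̃ = X⁰ ⊕ X¹`, with `X⁺`, `X⁰` Hilbert
spaces, `X⁰`, `X¹` closed, and `‖u‖² = ‖u⁺‖² + ‖ũ‖²`. -/
structure TripleSplitting where
  plus : Submodule ℝ X
  zero : Submodule ℝ X
  one : Submodule ℝ X
  isTopCompl : Submodule.IsTopCompl plus (zero ⊔ one)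
  disjoint : Disjoint zero one
  isClosed_zero : IsClosed (zero : Set X)
  isClosed_one : IsClosed (one : Set X)
  isHilbert_plus : IsHilbert plus
  isHilbert_zero : IsHilbert zero
  norm_sq : ∀ u ∈ plus, ∀ v ∈ zero ⊔ one, ‖u + v‖ ^ 2 = ‖u‖ ^ 2 + ‖v‖ ^ 2

variable {X}

/-- The decomposition `X = X⁺ ⊕ X̃`, where `X̃ = X⁰ ⊕ X¹`. -/
def TripleSplitting.main (T : TripleSplitting X) : Splitting X :=
  ⟨T.plus, T.zero ⊔ T.one, T.isTopCompl.isCompl⟩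

/-- The decomposition `X = (X⁺ ⊕ X⁰) ⊕ X¹`. -/
def TripleSplitting.cp (T : TripleSplitting X) : Splitting X :=
  ⟨T.plus ⊔ T.zero, T.one,
    T.disjoint.isCompl_sup_left_of_isCompl_sup_right T.isTopCompl.isCompl⟩

namespace Splitting

variable (S : Splitting X)

/-- The component of `u` in `plus`. -/
def proj (u : X) : X := S.plus.projection S.tilde S.isCompl u

/-- The component of `u` in `tilde`. -/
def coproj (u : X) : X := S.tilde.projection S.plus S.isCompl.symm u

/-- The functional `J u = ½ ‖u⁺‖² - I u`. -/
def energy (I : X → ℝ) (u : X) : ℝ := 1 / 2 * ‖S.proj u‖ ^ 2 - I u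

/-- The Nehari-Pankov set `{u ∈ X ∖ X̃ : J'(u) = 0 on ℝ u ⊕ X̃}` of the functional `energy I`. -/
def nehari (I : X → ℝ) : Set X :=
  {u | u ∉ S.tilde ∧ ∀ w ∈ Submodule.span ℝ {u} ⊔ S.tilde, fderiv ℝ (S.energy I) u w = 0}

/-- Sequential convergence in the topology that is the product of the norm topology of `plus` and
the weak topology of `tilde`. -/
def TTendsto (u : ℕ → X) (x : X) : Prop :=
  Tendsto (fun n => S.proj (u n)) atTop (𝓝 (S.proj x)) ∧
    WeakTendsto (fun n => S.coproj (u n)) (S.coproj x)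

/-- The structural conditions on the nonlinear part `I` of the functional `energy I`. -/
structure Conditions (I : X → ℝ) : Prop where
  A1 : ContDiff ℝ 1 I ∧ I 0 = 0 ∧ ∀ u, 0 ≤ I u
  A2 : ∀ (u : ℕ → X) (x : X), S.TTendsto u x →
    (I x : EReal) ≤ liminf (fun n => (I (u n) : EReal)) atTop
  A3 : ∀ (u : ℕ → X) (x : X), S.TTendsto u x →
    Tendsto (fun n => I (u n)) atTop (𝓝 (I x)) → Tendsto u atTop (𝓝 x)
  A4 : ∃ r > 0, ∃ a > 0, ∀ u ∈ S.plus, ‖u‖ = r → a ≤ S.energy I u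
  B1 : Tendsto (fun u => ‖S.proj u‖ + I u) (cobounded X) atTop
  B2 : ∀ (t : ℕ → ℝ) (u : ℕ → X) (x : X), Tendsto t atTop atTop → x ∈ S.plus → x ≠ 0 →
    Tendsto (fun n => S.proj (u n)) atTop (𝓝 x) →
    Tendsto (fun n => I (t n • u n) / t n ^ 2) atTop atTop
  B3 : ∀ u ∈ S.nehari I, ∀ t : ℝ, 0 ≤ t → ∀ v ∈ S.tilde, u ≠ t • u + v →
    (t ^ 2 - 1) / 2 * fderiv ℝ I u u + t * fderiv ℝ I u v + I u - I (t • u + v) < 0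

end Splitting

namespace TripleSplitting

variable (T : TripleSplitting X)

/-- The functional `J u = ½ ‖u⁺‖² - I u`. -/
def J (I : X → ℝ) : X → ℝ := T.main.energy I

/-- The Nehari-Pankov manifold of `J`. -/
def N (I : X → ℝ) : Set X := T.main.nehari I

/-- The functional `J_cp u = ½ ‖u⁺ + u⁰‖² - I_cp u`. -/
def Jcp (Icp : X → ℝ) : X → ℝ := T.cp.energy Icp

/-- The Nehari-Pankov manifold of `J_cp`. -/
def Ncp (Icp : X → ℝ) : Set X := T.cp.nehari Icp

/-- `J_cp` is compactly perturbed with respect to `J`; here `T.cp.proj u` is `u⁺ + u⁰`. -/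
def C1 (I Icp : X → ℝ) : Prop :=
  (∀ u : ℕ → X, (∀ n, u n ∈ T.Ncp Icp) → IsBounded (Set.range u) →
    WeakTendsto (fun n => T.cp.proj (u n)) 0 →
    Tendsto (fun n => T.Jcp Icp (u n) - T.J I (u n)) atTop (𝓝 0)) ∧
  ∃ M > 0, ∀ u ∈ T.Ncp Icp, T.Jcp Icp u - T.J I u ≤ M * ‖T.cp.proj u‖ ^ 2

/-- `I (t_n u_n) / t_n² → ∞` whenever `t_n → ∞` and, for every `s > 1`, the sequence `I (s u_n⁺)`
is bounded away from `0`. -/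
def C2 (I : X → ℝ) : Prop :=
  ∀ (t : ℕ → ℝ) (u : ℕ → X), Tendsto t atTop atTop →
    (∀ s : ℝ, 1 < s → ∃ δ > 0, ∀ n, δ ≤ I (s • T.main.proj (u n))) →
    Tendsto (fun n => I (t n • u n) / t n ^ 2) atTop atTop

/-- `J'` is weak-to-weak* continuous on `N`, and `J` is weakly sequentially lower semicontinuous
on `N`. -/
def C3 (I : X → ℝ) : Prop :=
  (∀ (u : ℕ → X) (x : X), (∀ n, u n ∈ T.N I) → WeakTendsto u x →
    ∀ w : X, Tendsto (fun n => fderiv ℝ (T.J I) (u n) w) atTop (𝓝 (fderiv ℝ (T.J I) x w))) ∧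
  ∀ (u : ℕ → X) (x : X), (∀ n, u n ∈ T.N I) → WeakTendsto u x → x ∈ T.N I →
    (T.J I x : EReal) ≤ liminf (fun n => (T.J I (u n) : EReal)) atTop

end TripleSplitting

end

end NehariPankov

/-! By (B3), a point of N is the strict maximum of J on its fibre {t u⁺ + v : t ≥ 0, v ∈ X̃}
(`energy_lt_of_mem_nehari`). Every fibre over a nonzero w ∈ X⁺ contains such a point
(`exists_isFibrePoint`), and it depends continuously on w (`tendsto_isFibrePoint`). So c is the
infimum over w of the fibrewise maximum. Ekeland's principle, applied to this function of w, whose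
differentiability is never needed, gives a minimizing sequence u_n in N with J'(u_n) → 0 pointwise
(`exists_palaisSmale_seq`).

Since X⁰ = 0, J and J_cp have the same fibres. If u₀ attains d and m ∈ N lies on the fibre of u₀,
then c ≤ J(m) < J_cp(m) ≤ J_cp(u₀) = d.

By coercivity, u_n ⇀ x along a subsequence, and x is critical by (C3). If x⁺ = 0, let m_n ∈ N_cp lie
on the fibre of u_n: then m_n⁺ ⇀ 0 and (C1) gives d ≤ J_cp(m_n) = J(m_n) + o(1) ≤ J(u_n) + o(1),
hence d ≤ c (`le_of_weakTendsto_zero`), a contradiction. So x ∈ N, and lower semicontinuity on N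
gives J(x) = c. -/

namespace NehariPankov

/-! ### Weak sequential compactness in reflexive spaces -/

section WeakCompactness

variable {X : Type*} [NormedAddCommGroup X] [NormedSpace ℝ X]

/-- In a reflexive space, a bounded sequence converges weakly along every ultrafilter. -/
theorem exists_weak_limit_ultrafilter (hX : IsReflexiveSpace X) {x : ℕ → X} {C : ℝ}
    (hC : ∀ n, ‖x n‖ ≤ C) (U : Ultrafilter ℕ) :
    ∃ y : X, ∀ f : StrongDual ℝ X, Tendsto (fun n => f (x n)) U (𝓝 (f y)) := by
  -- Banach–Alaoglu in the bidual; reflexivity pulls the limit back to `X`.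
  have hK : IsCompact (WeakDual.toStrongDual ⁻¹'
      Metric.closedBall (0 : StrongDual ℝ (StrongDual ℝ X)) C) :=
    WeakDual.isCompact_closedBall 0 C
  let e : ℕ → WeakDual ℝ (StrongDual ℝ X) := fun n =>
    StrongDual.toWeakDual (NormedSpace.inclusionInDoubleDual ℝ X (x n))
  have he : ∀ n, e n ∈ (WeakDual.toStrongDual ⁻¹'
      Metric.closedBall (0 : StrongDual ℝ (StrongDual ℝ X)) C) := fun n => by
    have h := (NormedSpace.double_dual_bound ℝ X (x n)).trans (hC n)
    have h' : NormedSpace.inclusionInDoubleDual ℝ X (x n) ∈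
        Metric.closedBall (0 : StrongDual ℝ (StrongDual ℝ X)) C := by
      rw [Metric.mem_closedBall]
      exact (dist_zero_right (E := StrongDual ℝ (StrongDual ℝ X)) _).trans_le h
    exact h'
  obtain ⟨Φ, -, hΦ⟩ := hK.ultrafilter_le_nhds (U.map e)
    (le_principal_iff.2 (Ultrafilter.mem_map.2 (Filter.univ_mem' he)))
  obtain ⟨y, hy⟩ := hX (WeakDual.toStrongDual Φ)
  refine ⟨y, fun f => ?_⟩
  have h1 : Tendsto e U (𝓝 Φ) := hΦ
  have h2 : Tendsto (fun n => e n f) U (𝓝 (Φ f)) :=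
    ((WeakDual.eval_continuous f).tendsto Φ).comp h1
  have h3 : Φ f = f y := by
    rw [← NormedSpace.dual_def ℝ X y f, hy]; rfl
  rw [h3] at h2
  exact h2

/-- Bounded sequences in a reflexive space have weakly convergent subsequences. -/
theorem exists_weakTendsto_subseq (hX : IsReflexiveSpace X) {x : ℕ → X} {C : ℝ}
    (hC : ∀ n, ‖x n‖ ≤ C) :
    ∃ φ : ℕ → ℕ, StrictMono φ ∧ ∃ y, WeakTendsto (fun n => x (φ n)) y := by
  -- The closed span is separable, so countably many functionals norming a dense sequence separate
  -- its points. Once these converge along a diagonal subsequence, all ultrafilter limits, which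
  -- stay in `Y` by Hahn–Banach, coincide.
  set Y : Submodule ℝ X := (Submodule.span ℝ (Set.range x)).topologicalClosure with hY
  have hxY : ∀ n, x n ∈ Y := fun n =>
    Submodule.le_topologicalClosure _ (Submodule.subset_span ⟨n, rfl⟩)
  have hYc : IsClosed (Y : Set X) := Submodule.isClosed_topologicalClosure _
  have hsep : TopologicalSpace.IsSeparable (Y : Set X) := by
    rw [hY, Submodule.topologicalClosure_coe]
    exact ((Set.countable_range x).isSeparable.span).closure
  obtain ⟨c, hc, hcY⟩ := hsep
  have hcne : c.Nonempty := by
    rw [Set.nonempty_iff_ne_empty]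
    rintro rfl
    simpa using hcY (hxY 0)
  obtain ⟨d, rfl⟩ := hc.exists_eq_range hcne
  choose f hf1 hf2 using fun j => exists_dual_vector'' ℝ (d j)
  have hsepar : ∀ z ∈ Y, (∀ j, f j z = 0) → z = 0 := by
    intro z hz h0
    by_contra hne
    have hpos : 0 < ‖z‖ := norm_pos_iff.2 hne
    obtain ⟨_, ⟨j, rfl⟩, hj⟩ := Metric.mem_closure_iff.1 (hcY hz) (‖z‖ / 2) (by linarith)
    have h1 : ‖d j‖ ≤ ‖d j - z‖ := by
      have : f j (d j - z) = ‖d j‖ := by rw [map_sub, h0 j, sub_zero, hf2 j]; simp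
      rw [← this]
      refine (le_abs_self _).trans (((f j).le_opNorm _).trans ?_)
      exact mul_le_of_le_one_left (norm_nonneg _) (hf1 j)
    have h2 : ‖z‖ ≤ ‖d j‖ + ‖d j - z‖ := by
      simpa [norm_sub_rev] using norm_sub_le (d j) (d j - z)
    rw [dist_eq_norm, norm_sub_rev] at hj
    linarith
  have hbox : ∀ n, (fun j => f j (x n)) ∈ Set.pi Set.univ (fun _ : ℕ => Set.Icc (-C) C) := by
    intro n j _
    rw [Set.mem_Icc, ← abs_le]
    exact ((f j).le_opNorm _).trans
      ((mul_le_of_le_one_left (norm_nonneg _) (hf1 j)).trans (hC n))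
  obtain ⟨g, -, φ, hφ, hg⟩ :=
    (isCompact_univ_pi fun _ : ℕ => isCompact_Icc (a := -C) (b := C)).tendsto_subseq hbox
  rw [tendsto_pi_nhds] at hg
  have hmem : ∀ (U : Ultrafilter ℕ) (y : X),
      (∀ f : StrongDual ℝ X, Tendsto (fun n => f (x (φ n))) U (𝓝 (f y))) → y ∈ Y := by
    intro U y hy
    by_contra hyY
    obtain ⟨k, u, hk, hu⟩ := geometric_hahn_banach_closed_point Y.convex hYc hyY
    exact absurd (le_of_tendsto (hy k) (Eventually.of_forall fun n => (hk _ (hxY _)).le))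
      (not_le.2 hu)
  obtain ⟨y, hy⟩ := exists_weak_limit_ultrafilter hX (fun n => hC (φ n)) (hyperfilter ℕ)
  refine ⟨φ, hφ, y, fun k => ?_⟩
  rw [tendsto_iff_ultrafilter]
  intro U hU
  obtain ⟨y', hy'⟩ := exists_weak_limit_ultrafilter hX (fun n => hC (φ n)) U
  have hh : (hyperfilter ℕ : Filter ℕ) ≤ atTop := by
    rw [← Nat.cofinite_eq_atTop]; exact hyperfilter_le_cofinite
  have : y' - y = 0 := by
    refine hsepar _ (Y.sub_mem (hmem U y' hy') (hmem _ y hy)) fun j => ?_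
    rw [map_sub, sub_eq_zero]
    rw [tendsto_nhds_unique (hy' (f j)) ((hg j).mono_left hU),
      tendsto_nhds_unique (hy (f j)) ((hg j).mono_left hh)]
  rw [sub_eq_zero] at this
  rw [← this]
  exact hy' k

end WeakCompactness

/-! ### Ekeland's principle and auxiliary facts on sequences and infima -/

/-- **Ekeland's variational principle**. -/
theorem exists_ekeland {α : Type*} [MetricSpace α] [CompleteSpace α] {f : α → ℝ}
    (hf : LowerSemicontinuous f) (hb : BddBelow (Set.range f)) {ε : ℝ} (hε : 0 < ε) (x₀ : α) :
    ∃ y, f y + ε * dist x₀ y ≤ f x₀ ∧ ∀ x, f y ≤ f x + ε * dist y x := by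
  -- `y ∈ S x` is Ekeland's partial order; a minimal element below `x₀` is sought.
  let S : α → Set α := fun x => {y | f y + ε * dist x y ≤ f x}
  have hrefl : ∀ x, x ∈ S x := fun x => by simp [S]
  have htrans : ∀ x y z, y ∈ S x → z ∈ S y → z ∈ S x := by
    intro x y z hy hz
    simp only [S, Set.mem_ofPred_eq] at *
    nlinarith [dist_triangle x y z]
  have hclosed : ∀ x, IsClosed (S x) := fun x => by
    have : LowerSemicontinuous fun y => f y + ε * dist x y :=
      hf.add (Continuous.lowerSemicontinuous (by fun_prop))
    exact this.isClosed_preimage (f x)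
  have hnear : ∀ (x : α) (δ : ℝ), 0 < δ → ∃ y ∈ S x, ∀ z ∈ S x, f y ≤ f z + δ := by
    intro x δ hδ
    have hbdd : BddBelow (f '' S x) := hb.mono (Set.image_subset_range _ _)
    obtain ⟨_, ⟨y, hy, rfl⟩, hlt⟩ :=
      Real.lt_sInf_add_pos (s := f '' S x) ⟨_, x, hrefl x, rfl⟩ hδ
    exact ⟨y, hy, fun z hz => by linarith [csInf_le hbdd ⟨z, hz, rfl⟩]⟩
  choose! g hgS hg using hnear
  -- The factor `ε` cancels the one in `S`, so that `S (x (n + 1))` lies within `1 / (n + 1)` of `x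
  -- (n + 1)`.
  let δ : ℕ → ℝ := fun n => ε * (1 / ((n : ℝ) + 1))
  have hδ : ∀ n, 0 < δ n := fun n => by positivity
  let x : ℕ → α := fun n => Nat.rec x₀ (fun n y => g y (δ n)) n
  have hxs : ∀ n, x (n + 1) = g (x n) (δ n) := fun n => rfl
  have hstep : ∀ n, x (n + 1) ∈ S (x n) := fun n => by rw [hxs]; exact hgS _ _ (hδ n)
  have hmono : ∀ n m, n ≤ m → x m ∈ S (x n) := by
    intro n m h
    induction h with
    | refl => exact hrefl _
    | step _ ih => exact htrans _ _ _ ih (hstep _)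
  have hsmall : ∀ n, ∀ z ∈ S (x (n + 1)), dist (x (n + 1)) z ≤ 1 / ((n : ℝ) + 1) := by
    intro n z hz
    have h1 := hg (x n) (δ n) (hδ n) z (htrans _ _ _ (hstep n) hz)
    rw [← hxs] at h1
    have h2 : f z + ε * dist (x (n + 1)) z ≤ f (x (n + 1)) := hz
    have h3 : ε * dist (x (n + 1)) z ≤ ε * (1 / ((n : ℝ) + 1)) := by
      change f (x (n + 1)) ≤ f z + ε * (1 / ((n : ℝ) + 1)) at h1
      linarith
    exact le_of_mul_le_mul_left h3 hε
  have hlim := tendsto_one_div_add_atTop_nhds_zero_nat (𝕜 := ℝ)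
  have hcau : CauchySeq fun n => x (n + 1) := by
    refine cauchySeq_of_le_tendsto_0' (fun n => 1 / ((n : ℝ) + 1)) (fun n m h => ?_) hlim
    exact hsmall n _ (hmono _ _ (Nat.succ_le_succ h))
  obtain ⟨y, hy⟩ := cauchySeq_tendsto_of_complete hcau
  have hyS : ∀ n, y ∈ S (x n) := fun n => by
    refine (hclosed (x n)).mem_of_tendsto hy ?_
    filter_upwards [eventually_ge_atTop n] with m hm
    exact hmono _ _ (Nat.le_succ_of_le hm)
  refine ⟨y, hyS 0, fun z => ?_⟩
  -- A violating `z` would lie in every `S (x n)`, hence be the limit `y` itself.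
  by_contra! hz
  have hzS : ∀ n, z ∈ S (x n) := fun n => htrans _ _ _ (hyS n) hz.le
  have h1 : Tendsto (fun n => x (n + 1)) atTop (𝓝 z) := by
    rw [tendsto_iff_dist_tendsto_zero]
    exact squeeze_zero (fun _ => dist_nonneg) (fun n => hsmall n z (hzS (n + 1))) hlim
  have := tendsto_nhds_unique hy h1
  subst this
  simp at hz

/-- A real sequence that is not bounded above tends to infinity along a subsequence. -/
theorem exists_strictMono_tendsto_atTop {t : ℕ → ℝ} (h : ¬ BddAbove (Set.range t)) :
    ∃ φ : ℕ → ℕ, StrictMono φ ∧ Tendsto (fun n => t (φ n)) atTop atTop := by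
  have hfr : ∀ n : ℕ, ∃ᶠ k in atTop, (n : ℝ) ≤ t k := by
    intro n hn
    refine h (Filter.IsBoundedUnder.bddAbove_range ⟨n, ?_⟩)
    rw [eventually_map]
    filter_upwards [hn] with k hk using (not_le.1 hk).le
  obtain ⟨φ, hφ, hn⟩ := extraction_forall_of_frequently hfr
  exact ⟨φ, hφ, tendsto_atTop_mono hn tendsto_natCast_atTop_atTop⟩

/-- The infimum in the extended reals is the greatest lower bound in the reals, if there is one. -/
theorem infOn_eq_coe {X : Type*} [NormedAddCommGroup X] [NormedSpace ℝ X] {J : X → ℝ} {N : Set X}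
    {c : ℝ} (h : IsGLB (J '' N) c) : infOn J N = c := by
  refine le_antisymm ?_ (le_iInf₂ fun u hu => EReal.coe_le_coe_iff.2 (h.1 ⟨u, hu, rfl⟩))
  refine EReal.le_of_forall_lt_iff_le.1 fun z hz => ?_
  obtain ⟨_, ⟨u, hu, rfl⟩, -, hlt⟩ := h.exists_between (EReal.coe_lt_coe_iff.1 hz)
  exact (iInf₂_le u hu).trans (EReal.coe_le_coe_iff.2 hlt.le)

/-- A coercive functional has bounded sublevel sets. -/
theorem CoerciveOn.exists_bound {X : Type*} [NormedAddCommGroup X] {J : X → ℝ} {N : Set X}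
    (h : CoerciveOn J N) (K : ℝ) : ∃ C, ∀ u ∈ N, J u ≤ K → ‖u‖ ≤ C := by
  have h1 := h.eventually_gt_atTop K
  rw [eventually_inf_principal, ← comap_norm_atTop, eventually_comap] at h1
  obtain ⟨C, hC⟩ := eventually_atTop.1 h1
  refine ⟨C, fun u hu hK => ?_⟩
  by_contra! hlt
  exact absurd (hC _ hlt.le u rfl hu) (not_lt.2 hK)

/-- Weak limits are unique. -/
theorem WeakTendsto.unique {X : Type*} [NormedAddCommGroup X] [NormedSpace ℝ X] {u : ℕ → X}
    {x y : X} (hx : WeakTendsto u x) (hy : WeakTendsto u y) : x = y :=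
  (SeparatingDual.eq_iff_forall_dual_eq (R := ℝ)).2 fun f => tendsto_nhds_unique (hx f) (hy f)

end NehariPankov

/-! ### Fibres and their Nehari–Pankov points -/

namespace NehariPankov
namespace Splitting

variable {X : Type*} [NormedAddCommGroup X] [NormedSpace ℝ X] {S : Splitting X} {I : X → ℝ}

section Algebra

variable (S)

theorem proj_mem (u : X) : S.proj u ∈ S.plus := Submodule.projection_apply_mem _ _

theorem coproj_mem (u : X) : S.coproj u ∈ S.tilde := Submodule.projection_apply_mem _ _

theorem proj_add_coproj (u : X) : S.proj u + S.coproj u = u :=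
  Submodule.projection_add_projection_eq_self S.isCompl u

theorem proj_add (u v : X) : S.proj (u + v) = S.proj u + S.proj v := map_add _ _ _

theorem proj_smul (t : ℝ) (u : X) : S.proj (t • u) = t • S.proj u := map_smul _ _ _

theorem proj_eq_zero_iff {u : X} : S.proj u = 0 ↔ u ∈ S.tilde :=
  Submodule.projection_apply_eq_zero_iff _

theorem proj_of_mem {u : X} (hu : u ∈ S.plus) : S.proj u = u :=
  Submodule.projection_apply_of_mem_left _ hu

theorem proj_smul_add {w v : X} (hw : w ∈ S.plus) (hv : v ∈ S.tilde) (t : ℝ) :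
    S.proj (t • w + v) = t • w := by
  rw [S.proj_add, S.proj_smul, S.proj_of_mem hw, S.proj_eq_zero_iff.2 hv, add_zero]

/-- The projection as a continuous linear map. -/
noncomputable def projL (h : Continuous S.proj) : X →L[ℝ] X :=
  ⟨S.plus.projection S.tilde S.isCompl, h⟩

theorem proj_weakTendsto (h : Continuous S.proj) {u : ℕ → X} {x : X} (hu : WeakTendsto u x) :
    WeakTendsto (fun n => S.proj (u n)) (S.proj x) :=
  fun f => hu (f.comp (S.projL h))

theorem coproj_eq_sub (u : X) : S.coproj u = u - S.proj u :=
  eq_sub_of_add_eq' (S.proj_add_coproj u)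

theorem coproj_weakTendsto (h : Continuous S.proj) {u : ℕ → X} {x : X} (hu : WeakTendsto u x) :
    WeakTendsto (fun n => S.coproj (u n)) (S.coproj x) := fun f => by
  simp only [coproj_eq_sub, map_sub]
  exact (hu f).sub (S.proj_weakTendsto h hu f)

end Algebra

theorem energy_add_self (S : Splitting X) (I : X → ℝ) (u : X) :
    I u = 1 / 2 * ‖S.proj u‖ ^ 2 - S.energy I u := by simp [energy]

theorem Conditions.energy_le (hI : S.Conditions I) (u : X) :
    S.energy I u ≤ 1 / 2 * ‖S.proj u‖ ^ 2 := by
  have := hI.A1.2.2 u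
  simp only [energy]; linarith

/-- Points `t w + v` of a fibre on which the energy is nonnegative stay bounded as long as `w`
converges to a nonzero limit. -/
theorem Conditions.exists_bound (hI : S.Conditions I) {w : ℕ → X} {w₀ : X} {t : ℕ → ℝ} {v : ℕ → X}
    (hw : ∀ n, w n ∈ S.plus) (hw₀ : w₀ ∈ S.plus) (hne : w₀ ≠ 0) (hlim : Tendsto w atTop (𝓝 w₀))
    (ht : ∀ n, 0 ≤ t n) (hv : ∀ n, v n ∈ S.tilde) (hE : ∀ n, 0 ≤ S.energy I (t n • w n + v n)) :
    BddAbove (Set.range t) ∧ ∃ C, ∀ n, ‖t n • w n + v n‖ ≤ C := by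
  have hle : ∀ n, I (t n • w n + v n) ≤ 1 / 2 * (t n * ‖w n‖) ^ 2 := fun n => by
    have h1 := hE n
    rw [energy, S.proj_smul_add (hw n) (hv n), norm_smul, Real.norm_of_nonneg (ht n)] at h1
    linarith
  obtain ⟨D, hD⟩ := hlim.norm.bddAbove_range
  have hD' : ∀ n, ‖w n‖ ≤ D := fun n => hD ⟨n, rfl⟩
  -- If `t → ∞`, (B2) for `w + t⁻¹ v` makes `I / t²` unbounded, while nonnegative energy bounds it
  -- by `D² / 2`.
  have hbt : BddAbove (Set.range t) := by
    by_contra hub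
    obtain ⟨φ, hφ, htφ⟩ := exists_strictMono_tendsto_atTop hub
    have hB := hI.B2 (fun n => t (φ n)) (fun n => w (φ n) + (t (φ n))⁻¹ • v (φ n)) w₀ htφ hw₀ hne
      (by
        have : ∀ n, S.proj (w (φ n) + (t (φ n))⁻¹ • v (φ n)) = w (φ n) := fun n => by
          simpa using S.proj_smul_add (hw (φ n)) (S.tilde.smul_mem (t (φ n))⁻¹ (hv (φ n))) 1
        simp only [this]
        exact hlim.comp hφ.tendsto_atTop)
    obtain ⟨n, h1, h2⟩ := ((hB.eventually_gt_atTop (1 / 2 * D ^ 2)).and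
      (htφ.eventually_gt_atTop 0)).exists
    rw [smul_add, smul_smul, mul_inv_cancel₀ h2.ne', one_smul, lt_div_iff₀ (by positivity)] at h1
    have h3 := hle (φ n)
    have h4 : (t (φ n) * ‖w (φ n)‖) ^ 2 ≤ (t (φ n) * D) ^ 2 := by
      have := hD' (φ n)
      gcongr
    nlinarith
  refine ⟨hbt, ?_⟩
  obtain ⟨A, hA⟩ := hbt
  have hA' : ∀ n, t n ≤ A := fun n => hA ⟨n, rfl⟩
  have hA0 : 0 ≤ A := (ht 0).trans (hA' 0)
  have hb : ∀ n, t n * ‖w n‖ ≤ A * D := fun n => by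
    have h1 := hA' n
    have h2 := hD' n
    gcongr
  -- The threshold is the sum of the bounds `A * D` for the plus part and `(A * D)² / 2` for `I`.
  have hev := hI.B1.eventually_gt_atTop (A * D + 1 / 2 * (A * D) ^ 2)
  rw [← comap_norm_atTop, eventually_comap] at hev
  obtain ⟨C, hC⟩ := eventually_atTop.1 hev
  refine ⟨C, fun n => ?_⟩
  by_contra! hlt
  have h1 := hC _ hlt.le _ rfl
  rw [S.proj_smul_add (hw n) (hv n), norm_smul, Real.norm_of_nonneg (ht n)] at h1
  have h2 := hle n
  have h3 : (t n * ‖w n‖) ^ 2 ≤ (A * D) ^ 2 :=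
    pow_le_pow_left₀ (mul_nonneg (ht n) (norm_nonneg _)) (hb n) 2
  linarith [hb n]

/-- Compactness of the points of nonnegative energy on converging fibres, and upper semicontinuity
of the energy along them. -/
theorem Conditions.exists_subseq (hI : S.Conditions I) (hX : IsReflexiveSpace X)
    (hc : Continuous S.proj) {w : ℕ → X} {w₀ : X} {t : ℕ → ℝ} {v : ℕ → X}
    (hw : ∀ n, w n ∈ S.plus) (hw₀ : w₀ ∈ S.plus) (hne : w₀ ≠ 0) (hlim : Tendsto w atTop (𝓝 w₀))
    (ht : ∀ n, 0 ≤ t n) (hv : ∀ n, v n ∈ S.tilde) (hE : ∀ n, 0 ≤ S.energy I (t n • w n + v n)) :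
    ∃ φ : ℕ → ℕ, StrictMono φ ∧ ∃ τ : ℝ, 0 ≤ τ ∧ ∃ y ∈ S.tilde, ∃ L,
      Tendsto (fun n => S.energy I (t (φ n) • w (φ n) + v (φ n))) atTop (𝓝 L) ∧
      L ≤ S.energy I (τ • w₀ + y) ∧
      (L = S.energy I (τ • w₀ + y) →
        Tendsto (fun n => t (φ n) • w (φ n) + v (φ n)) atTop (𝓝 (τ • w₀ + y))) := by
  obtain ⟨⟨A, hA⟩, C, hC⟩ := hI.exists_bound hw hw₀ hne hlim ht hv hE
  obtain ⟨D, hD⟩ := hlim.norm.bddAbove_range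
  have hD' : ∀ n, ‖w n‖ ≤ D := fun n => hD ⟨n, rfl⟩
  have hA' : ∀ n, t n ≤ A := fun n => hA ⟨n, rfl⟩
  have hA0 : 0 ≤ A := (ht 0).trans (hA' 0)
  have hEb : ∀ n, S.energy I (t n • w n + v n) ≤ 1 / 2 * (A * D) ^ 2 := fun n => by
    refine (hI.energy_le _).trans ?_
    rw [S.proj_smul_add (hw n) (hv n), norm_smul, Real.norm_of_nonneg (ht n)]
    have h1 := hA' n
    have h2 := hD' n
    have h3 := ht n
    gcongr
  obtain ⟨φ₁, hφ₁, x, hx⟩ := exists_weakTendsto_subseq hX hC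
  obtain ⟨τ, hτ, φ₂, hφ₂, htτ⟩ := (isCompact_Icc (a := (0 : ℝ)) (b := A)).tendsto_subseq
    (x := fun n => t (φ₁ n)) fun n => ⟨ht _, hA' _⟩
  obtain ⟨L, hL, φ₃, hφ₃, hLE⟩ :=
    (isCompact_Icc (a := (0 : ℝ)) (b := 1 / 2 * (A * D) ^ 2)).tendsto_subseq
      (x := fun n => S.energy I (t (φ₁ (φ₂ n)) • w (φ₁ (φ₂ n)) + v (φ₁ (φ₂ n))))
      fun n => ⟨hE _, hEb _⟩
  set φ : ℕ → ℕ := fun n => φ₁ (φ₂ (φ₃ n))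
  have hφ : StrictMono φ := hφ₁.comp (hφ₂.comp hφ₃)
  have hxφ : WeakTendsto (fun n => t (φ n) • w (φ n) + v (φ n)) x := fun f =>
    (hx f).comp (hφ₂.comp hφ₃).tendsto_atTop
  have htφ : Tendsto (fun n => t (φ n)) atTop (𝓝 τ) := htτ.comp hφ₃.tendsto_atTop
  have hpr : Tendsto (fun n => S.proj (t (φ n) • w (φ n) + v (φ n))) atTop (𝓝 (τ • w₀)) := by
    simp only [fun n => S.proj_smul_add (hw (φ n)) (hv (φ n))]
    exact htφ.smul (hlim.comp hφ.tendsto_atTop)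
  -- The plus parts converge in norm, which upgrades weak convergence to the convergence required by
  -- (A2) and (A3).
  have hpx : S.proj x = τ • w₀ :=
    (S.proj_weakTendsto hc hxφ).unique fun f => (f.continuous.tendsto _).comp hpr
  have hxeq : τ • w₀ + S.coproj x = x := by rw [← hpx, S.proj_add_coproj]
  have hT : S.TTendsto (fun n => t (φ n) • w (φ n) + v (φ n)) x :=
    ⟨by rw [hpx]; exact hpr, S.coproj_weakTendsto hc hxφ⟩
  have hIlim : Tendsto (fun n => I (t (φ n) • w (φ n) + v (φ n))) atTop
      (𝓝 (1 / 2 * ‖S.proj x‖ ^ 2 - L)) := by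
    simp only [S.energy_add_self I]
    exact (hT.1.norm.pow 2 |>.const_mul (1 / 2)).sub hLE
  refine ⟨φ, hφ, τ, hτ.1, S.coproj x, S.coproj_mem x, L, hLE, ?_, ?_⟩
  · have h1 := hI.A2 _ _ hT
    rw [(EReal.tendsto_coe.2 hIlim).liminf_eq, EReal.coe_le_coe_iff] at h1
    rw [hxeq, energy]
    linarith
  · intro hLx
    rw [hxeq] at hLx ⊢
    refine hI.A3 _ _ hT ?_
    rw [S.energy_add_self I x, ← hLx]
    exact hIlim

/-- `fderiv` of the energy in terms of `fderiv I`, in the directions `u` and `v ∈ tilde`. -/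
theorem fderiv_energy_eq (hE : ContDiff ℝ 1 (S.energy I)) (hI : S.Conditions I) (u : X) {v : X}
    (hv : v ∈ S.tilde) (s : ℝ) :
    fderiv ℝ (S.energy I) u (s • u + v) = s * ‖S.proj u‖ ^ 2 - fderiv ℝ I u (s • u + v) := by
  have hd : ∀ {f : X → ℝ}, ContDiff ℝ 1 f →
      HasDerivAt (fun h : ℝ => f (u + h • (s • u + v))) (fderiv ℝ f u (s • u + v)) 0 := by
    intro f hf
    have h1 : HasFDerivAt f (fderiv ℝ f u) (u + (0 : ℝ) • (s • u + v)) := by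
      simpa using (hf.differentiable (by norm_num) u).hasFDerivAt
    have h2 : HasDerivAt (fun h : ℝ => u + h • (s • u + v)) (s • u + v) 0 := by
      simpa using ((hasDerivAt_id (0 : ℝ)).smul_const (s • u + v)).const_add u
    exact h1.comp_hasDerivAt 0 h2
  -- The norm itself is never differentiated: along the line in direction `s u + v`, energy plus `I`
  -- is an explicit quadratic polynomial.
  have h3 := (hd hE).add (hd hI.A1.1)
  have h4 : HasDerivAt (fun h : ℝ => 1 / 2 * ((1 + h * s) * ‖S.proj u‖) ^ 2)
      (s * ‖S.proj u‖ ^ 2) 0 := by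
    have h5 : HasDerivAt (fun h : ℝ => (1 + h * s) * ‖S.proj u‖) (s * ‖S.proj u‖) 0 := by
      simpa using (((hasDerivAt_id (0 : ℝ)).mul_const s).const_add 1).mul_const ‖S.proj u‖
    refine ((h5.pow 2).const_mul (1 / 2)).congr_deriv ?_
    norm_num
    ring
  have h6 : (fun h : ℝ => S.energy I (u + h • (s • u + v))) +
      (fun h : ℝ => I (u + h • (s • u + v))) =
      fun h : ℝ => 1 / 2 * ((1 + h * s) * ‖S.proj u‖) ^ 2 := by
    funext h
    have : S.proj (u + h • (s • u + v)) = (1 + h * s) • S.proj u := by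
      rw [S.proj_add, S.proj_smul, S.proj_add, S.proj_smul, S.proj_eq_zero_iff.2 hv, add_zero,
        smul_smul, add_smul, one_smul]
    simp only [Pi.add_apply, energy, this, norm_smul, mul_pow, Real.norm_eq_abs, sq_abs]
    ring
  rw [h6] at h3
  have := h3.unique h4
  linarith

/-- A point of the Nehari-Pankov set is the strict maximum of the energy on its fibre. -/
theorem energy_lt_of_mem_nehari (hE : ContDiff ℝ 1 (S.energy I)) (hI : S.Conditions I) {u : X}
    (hu : u ∈ S.nehari I) {t : ℝ} (ht : 0 ≤ t) {v : X} (hv : v ∈ S.tilde) (hne : u ≠ t • u + v) :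
    S.energy I (t • u + v) < S.energy I u := by
  have h0 := hI.B3 u hu t ht v hv hne
  -- With I'(u)u = ‖u⁺‖² and I'(u)v = 0, the left side of (B3) is exactly the energy difference.
  have hu1 : fderiv ℝ I u u = ‖S.proj u‖ ^ 2 := by
    have h1 := hu.2 u (Submodule.mem_sup_left (Submodule.mem_span_singleton_self u))
    have h2 := fderiv_energy_eq hE hI u S.tilde.zero_mem 1
    simp only [one_smul, add_zero, one_mul] at h2
    linarith
  have hv1 : fderiv ℝ I u v = 0 := by
    have h1 := hu.2 v (Submodule.mem_sup_right hv)
    have h2 := fderiv_energy_eq hE hI u hv 0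
    simp only [zero_smul, zero_add, zero_mul] at h2
    linarith
  rw [hu1, hv1] at h0
  simp only [energy, S.proj_add, S.proj_smul, S.proj_eq_zero_iff.2 hv, add_zero, norm_smul, mul_pow,
    Real.norm_eq_abs, sq_abs]
  linarith

/-- `m` is a point of the Nehari-Pankov set on the fibre `{t w + v : t > 0, v ∈ tilde}`. -/
def IsFibrePoint (S : Splitting X) (I : X → ℝ) (w : X) (t : ℝ) (m : X) : Prop :=
  m ∈ S.nehari I ∧ 0 < t ∧ m - t • w ∈ S.tilde

/-- The fibre over `w` is also that of `m`: since `t > 0`, each `s w + v` is `(s / t) m` plus an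
element of `tilde`. -/
theorem IsFibrePoint.lt (hE : ContDiff ℝ 1 (S.energy I)) (hI : S.Conditions I)
    {w m : X} {t : ℝ} (h : S.IsFibrePoint I w t m) {s : ℝ} (hs : 0 ≤ s) {v : X} (hv : v ∈ S.tilde)
    (hne : m ≠ s • w + v) : S.energy I (s • w + v) < S.energy I m := by
  obtain ⟨hm, ht, hmem⟩ := h
  have heq : s • w + v = (s / t) • m + (v - (s / t) • (m - t • w)) := by
    rw [smul_sub, smul_smul, div_mul_cancel₀ _ ht.ne']
    abel
  rw [heq] at hne ⊢
  exact energy_lt_of_mem_nehari hE hI hm (by positivity)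
    (S.tilde.sub_mem hv (S.tilde.smul_mem _ hmem)) hne

theorem IsFibrePoint.le (hE : ContDiff ℝ 1 (S.energy I)) (hI : S.Conditions I)
    {w m : X} {t : ℝ} (h : S.IsFibrePoint I w t m) {s : ℝ} (hs : 0 ≤ s) {v : X}
    (hv : v ∈ S.tilde) : S.energy I (s • w + v) ≤ S.energy I m := by
  by_cases hne : m = s • w + v
  · rw [← hne]
  · exact (h.lt hE hI hs hv hne).le

theorem IsFibrePoint.proj_eq {w m : X} {t : ℝ} (h : S.IsFibrePoint I w t m) (hw : w ∈ S.plus) :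
    S.proj m = t • w := by
  have := S.proj_smul_add hw h.2.2 t
  rwa [add_sub_cancel] at this

theorem proj_ne_zero_of_mem_nehari {u : X} (hu : u ∈ S.nehari I) : S.proj u ≠ 0 :=
  fun h => hu.1 (S.proj_eq_zero_iff.1 h)

theorem isFibrePoint_proj {u : X} (hu : u ∈ S.nehari I) {r : ℝ} (hr : 0 < r) :
    S.IsFibrePoint I (r • S.proj u) r⁻¹ u := by
  refine ⟨hu, by positivity, ?_⟩
  rw [smul_smul, inv_mul_cancel₀ hr.ne', one_smul, ← S.coproj_eq_sub]
  exact S.coproj_mem u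

/-- The energy is bounded below by a positive constant on the Nehari-Pankov set. -/
theorem exists_pos_le_energy (hE : ContDiff ℝ 1 (S.energy I)) (hI : S.Conditions I) :
    ∃ a > 0, ∀ u ∈ S.nehari I, a ≤ S.energy I u := by
  obtain ⟨r, hr, a, ha, h⟩ := hI.A4
  refine ⟨a, ha, fun u hu => ?_⟩
  have hpos : 0 < ‖S.proj u‖ := norm_pos_iff.2 (proj_ne_zero_of_mem_nehari hu)
  -- Comparison with the point of norm `r` on the ray through `u⁺`, where (A4) applies.
  have h1 := (isFibrePoint_proj hu zero_lt_one).le hE hI (s := r / ‖S.proj u‖) (by positivity)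
    S.tilde.zero_mem
  rw [one_smul, add_zero] at h1
  refine (h _ (S.plus.smul_mem _ (S.proj_mem u)) ?_).trans h1
  rw [norm_smul, Real.norm_of_nonneg (by positivity), div_mul_cancel₀ _ hpos.ne']

/-- Every fibre over a nonzero point of `plus` meets the Nehari-Pankov set. -/
theorem exists_isFibrePoint (hX : IsReflexiveSpace X) (hc : Continuous S.proj)
    (hE : ContDiff ℝ 1 (S.energy I)) (hI : S.Conditions I) {w : X} (hw : w ∈ S.plus)
    (hne : w ≠ 0) : ∃ t m, S.IsFibrePoint I w t m := by
  obtain ⟨r, hr, a, ha, hra⟩ := hI.A4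
  have hwpos : 0 < ‖w‖ := norm_pos_iff.2 hne
  set A : Set ℝ := {e | ∃ s : ℝ, 0 ≤ s ∧ ∃ v ∈ S.tilde, e = S.energy I (s • w + v)} with hA
  have hmem : S.energy I ((r / ‖w‖) • w) ∈ A :=
    ⟨r / ‖w‖, by positivity, 0, S.tilde.zero_mem, by rw [add_zero]⟩
  have hlow : a ≤ S.energy I ((r / ‖w‖) • w) := by
    refine hra _ (S.plus.smul_mem _ hw) ?_
    rw [norm_smul, Real.norm_of_nonneg (by positivity), div_mul_cancel₀ _ hwpos.ne']
  have hbdd : BddAbove A := by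
    by_contra hub
    rw [not_bddAbove_iff] at hub
    choose e heA hge using fun n : ℕ => hub n
    choose s hs v hv hsv using heA
    have hpos : ∀ n, 0 ≤ S.energy I (s n • w + v n) := fun n => by
      rw [← hsv]; exact (Nat.cast_nonneg n).trans (hge n).le
    obtain ⟨⟨D, hD⟩, -⟩ := hI.exists_bound (fun _ => hw) hw hne tendsto_const_nhds hs hv hpos
    obtain ⟨n, hn⟩ := exists_nat_gt (1 / 2 * (D * ‖w‖) ^ 2)
    have h1 := hI.energy_le (s n • w + v n)
    rw [S.proj_smul_add hw (hv n), norm_smul, Real.norm_of_nonneg (hs n), ← hsv] at h1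
    have h2 : s n ≤ D := hD ⟨n, rfl⟩
    have h3 : (s n * ‖w‖) ^ 2 ≤ (D * ‖w‖) ^ 2 := by
      have := hs n
      gcongr
    linarith [hge n]
  have hsup : a ≤ sSup A := hlow.trans (le_csSup hbdd hmem)
  obtain ⟨e, -, he, heA⟩ := exists_seq_tendsto_sSup ⟨_, hmem⟩ hbdd
  -- The index shift by `N` makes all energies of the maximizing sequence nonnegative.
  obtain ⟨N, hN⟩ := eventually_atTop.1 (he.eventually_const_le (ha.trans_le hsup))
  choose s hs v hv hsv using fun n => heA (n + N)
  have hpos : ∀ n, 0 ≤ S.energy I (s n • w + v n) := fun n => by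
    rw [← hsv]; exact hN _ (Nat.le_add_left _ _)
  obtain ⟨φ, hφ, τ, hτ, y, hy, L, hL, hLe, -⟩ :=
    hI.exists_subseq hX hc (fun _ => hw) hw hne tendsto_const_nhds hs hv hpos
  have hLs : L = sSup A := by
    refine tendsto_nhds_unique hL ?_
    simp only [← hsv]
    exact ((tendsto_add_atTop_iff_nat N).2 he).comp hφ.tendsto_atTop
  have hmax : ∀ s' : ℝ, 0 ≤ s' → ∀ v' ∈ S.tilde,
      S.energy I (s' • w + v') ≤ S.energy I (τ • w + y) := fun s' hs' v' hv' =>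
    (le_csSup hbdd ⟨s', hs', v', hv', rfl⟩).trans (hLs ▸ hLe)
  -- On `tilde` the energy is at most `0`, below the level `a`.
  have hτpos : 0 < τ := by
    refine hτ.lt_of_ne' fun h0 => ?_
    have h1 := hI.energy_le (τ • w + y)
    rw [S.proj_smul_add hw hy, h0, zero_smul, norm_zero] at h1
    have : a ≤ S.energy I ((0 : ℝ) • w + y) := by
      rw [← h0]; exact hsup.trans (hLs ▸ hLe)
    rw [zero_smul] at this
    linarith
  refine ⟨τ, τ • w + y, ⟨fun h => ?_, fun z hz => ?_⟩, hτpos, by rwa [add_sub_cancel_left]⟩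
  · rw [← S.proj_eq_zero_iff, S.proj_smul_add hw hy] at h
    exact (smul_ne_zero hτpos.ne' hne) h
  · obtain ⟨z₁, hz₁, z₂, hz₂, rfl⟩ := Submodule.mem_sup.1 hz
    obtain ⟨k, rfl⟩ := Submodule.mem_span_singleton.1 hz₁
    set u := τ • w + y with hu
    have h1 : HasFDerivAt (S.energy I) (fderiv ℝ (S.energy I) u)
        (u + (0 : ℝ) • (k • u + z₂)) := by
      simpa using (hE.differentiable (by norm_num) u).hasFDerivAt
    have h2 : HasDerivAt (fun h : ℝ => u + h • (k • u + z₂)) (k • u + z₂) 0 := by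
      simpa using ((hasDerivAt_id (0 : ℝ)).smul_const (k • u + z₂)).const_add u
    -- For small `h` one has `1 + h k > 0`, so the line stays on the fibre that `u` maximizes.
    refine IsLocalMax.hasDerivAt_eq_zero ?_ (h1.comp_hasDerivAt 0 h2)
    have hev : ∀ᶠ h : ℝ in 𝓝 0, 0 < 1 + h * k := by
      have : Tendsto (fun h : ℝ => 1 + h * k) (𝓝 0) (𝓝 (1 + 0 * k)) :=
        Continuous.tendsto (by fun_prop) 0
      exact this.eventually_const_lt (by simp)
    filter_upwards [hev] with h hh
    have heq : u + h • (k • u + z₂) = ((1 + h * k) * τ) • w + ((1 + h * k) • y + h • z₂) := by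
      rw [hu]; module
    simp only [Function.comp_apply, zero_smul, add_zero]
    rw [heq]
    exact hmax _ (by positivity) _ (S.tilde.add_mem (S.tilde.smul_mem _ hy) (S.tilde.smul_mem _ hz₂))

/-- The point of the Nehari-Pankov set on a fibre depends continuously on the fibre. -/
theorem tendsto_isFibrePoint (hX : IsReflexiveSpace X) (hc : Continuous S.proj)
    (hE : ContDiff ℝ 1 (S.energy I)) (hI : S.Conditions I) {w : ℕ → X} {w₀ : X}
    (hw : ∀ n, w n ∈ S.plus) (hw₀ : w₀ ∈ S.plus) (hne : w₀ ≠ 0) (hlim : Tendsto w atTop (𝓝 w₀))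
    {t : ℕ → ℝ} {m : ℕ → X} {t₀ : ℝ} {m₀ : X} (hm : ∀ n, S.IsFibrePoint I (w n) (t n) (m n))
    (hm₀ : S.IsFibrePoint I w₀ t₀ m₀) : Tendsto m atTop (𝓝 m₀) := by
  obtain ⟨a, ha, hage⟩ := exists_pos_le_energy hE hI
  refine tendsto_of_subseq_tendsto fun ns hns => ?_
  have heq : ∀ n, t n • w n + (m n - t n • w n) = m n := fun n => by abel
  obtain ⟨φ, hφ, τ, hτ, y, hy, L, hL, hLe, himp⟩ := hI.exists_subseq hX hc
    (w := fun n => w (ns n)) (t := fun n => t (ns n)) (v := fun n => m (ns n) - t (ns n) • w (ns n))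
    (fun n => hw _) hw₀ hne (hlim.comp hns) (fun n => (hm _).2.1.le) (fun n => (hm _).2.2)
    (fun n => by simp only [heq]; exact ha.le.trans (hage _ (hm _).1))
  simp only [heq] at hL himp
  have hnsφ : Tendsto (fun n => ns (φ n)) atTop atTop := hns.comp hφ.tendsto_atTop
  -- The competitor `t₀ w_n + (m₀ - t₀ w₀)` lies on the fibre of `w_n` and tends to `m₀`. With upper
  -- semicontinuity and strictness of the maximum this identifies the limit.
  have hge : S.energy I m₀ ≤ L := by
    have h1 : Tendsto (fun n => S.energy I (t₀ • w (ns (φ n)) + (m₀ - t₀ • w₀))) atTop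
        (𝓝 (S.energy I m₀)) := by
      have h2 : Tendsto (fun n => t₀ • w (ns (φ n)) + (m₀ - t₀ • w₀)) atTop (𝓝 m₀) := by
        have := ((hlim.comp hnsφ).const_smul t₀).add_const (m₀ - t₀ • w₀)
        rwa [add_sub_cancel] at this
      exact (hE.continuous.tendsto _).comp h2
    exact le_of_tendsto_of_tendsto' h1 hL fun n => (hm _).le hE hI hm₀.2.1.le hm₀.2.2
  have hle := hm₀.le hE hI hτ hy
  have hm₀eq : m₀ = τ • w₀ + y := by
    by_contra hcon
    linarith [hm₀.lt hE hI hτ hy hcon]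
  refine ⟨φ, ?_⟩
  rw [hm₀eq]
  exact himp (by linarith [hm₀eq ▸ hge])

end Splitting
end NehariPankov

/-! ### Almost critical minimizing sequences -/

namespace NehariPankov
namespace Splitting

variable {X : Type*} [NormedAddCommGroup X] [NormedSpace ℝ X] {S : Splitting X} {I : X → ℝ}

/-- If the fibrewise maximum of the energy has an approximate local minimum at `w`, then the
derivative of the energy at the maximum point is almost nonnegative. -/
theorem neg_le_mul_fderiv (hX : IsReflexiveSpace X) (hc : Continuous S.proj)
    (hE : ContDiff ℝ 1 (S.energy I)) (hI : S.Conditions I) {w : X} (hw : w ∈ S.plus)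
    (hne : w ≠ 0) {t : ℝ} {m : X} (hm : S.IsFibrePoint I w t m) {ε : ℝ}
    (hmin : ∀ᶠ w' in 𝓝 w, w' ∈ S.plus → ∀ t' m', S.IsFibrePoint I w' t' m' →
      S.energy I m ≤ S.energy I m' + ε * ‖w' - w‖) {z : X} (hz : z ∈ S.plus) :
    -(ε * ‖z‖) ≤ t * fderiv ℝ (S.energy I) m z := by
  have hlim₀ := tendsto_one_div_add_atTop_nhds_zero_nat (𝕜 := ℝ)
  have hpath : Tendsto (fun h : ℝ => w + h • z) (𝓝 0) (𝓝 w) := by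
    have : Continuous fun h : ℝ => w + h • z := by fun_prop
    simpa using this.tendsto 0
  have hev := (hpath.comp hlim₀).eventually (hmin.and (isOpen_ne.mem_nhds hne))
  obtain ⟨N, hN⟩ := eventually_atTop.1 hev
  set h : ℕ → ℝ := fun k => 1 / (((k + N : ℕ) : ℝ) + 1) with hh
  have hpos : ∀ k, 0 < h k := fun k => by positivity
  have hlim : Tendsto h atTop (𝓝 0) := (tendsto_add_atTop_iff_nat N).2 hlim₀
  have hN' : ∀ k, (w + h k • z ∈ S.plus → ∀ t' m', S.IsFibrePoint I (w + h k • z) t' m' →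
      S.energy I m ≤ S.energy I m' + ε * ‖w + h k • z - w‖) ∧ w + h k • z ≠ 0 := fun k =>
    hN (k + N) (Nat.le_add_left _ _)
  have hwk : ∀ k, w + h k • z ∈ S.plus := fun k => S.plus.add_mem hw (S.plus.smul_mem _ hz)
  choose s p hp using fun k => exists_isFibrePoint hX hc hE hI (hwk k) (hN' k).2
  have hwlim : Tendsto (fun k => w + h k • z) atTop (𝓝 w) := hpath.comp hlim
  have hplim : Tendsto p atTop (𝓝 m) :=
    tendsto_isFibrePoint hX hc hE hI hwk hw hne hwlim hp hm
  -- The scalars are recovered from the points as the quotient ‖p⁺‖ / ‖w‖.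
  have hslim : Tendsto s atTop (𝓝 t) := by
    have h1 : Tendsto (fun k => ‖S.proj (p k)‖ / ‖w + h k • z‖) atTop (𝓝 (‖S.proj m‖ / ‖w‖)) :=
      ((hc.tendsto m).comp hplim).norm.div hwlim.norm (norm_ne_zero_iff.2 hne)
    have h2 : ∀ {w' p' : X} {s' : ℝ}, w' ∈ S.plus → w' ≠ 0 → S.IsFibrePoint I w' s' p' →
        ‖S.proj p'‖ / ‖w'‖ = s' := fun hw' hne' hp' => by
      rw [hp'.proj_eq hw', norm_smul, Real.norm_of_nonneg hp'.2.1.le,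
        mul_div_cancel_right₀ _ (norm_ne_zero_iff.2 hne')]
    rw [h2 hw hne hm] at h1
    simpa only [h2 (hwk _) (hN' _).2 (hp _)] using h1
  -- `b k` is `p k` moved back to the fibre of `w`, so its energy is at most that of `m`. Hence the
  -- energies of `p k` and `b k` differ by at least `-ε h ‖z‖`, and strict differentiability at `m`
  -- computes the limit of the quotient.
  set b : ℕ → X := fun k => p k - (h k * s k) • z with hb
  have hblim : Tendsto b atTop (𝓝 m) := by
    have := hplim.sub ((hlim.mul hslim).smul_const z)
    simpa using this
  have hstrict := ((hE.contDiffAt (x := m)).hasStrictFDerivAt (by norm_num)).isLittleO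
  have hO := hstrict.comp_tendsto (hplim.prodMk_nhds hblim)
  have hO2 : (fun k => p k - b k) =O[atTop] h := by
    have h1 : (fun k => p k - b k) = fun k => h k • (s k • z) := by
      funext k; simp [hb, mul_smul]
    rw [h1]
    have h2 : (fun k => s k • z) =O[atTop] fun _ => (1 : ℝ) :=
      (hslim.smul_const z).isBigO_one ℝ
    simpa using (Asymptotics.isBigO_refl h atTop).smul h2
  have hR := (hO.trans_isBigO hO2).tendsto_div_nhds_zero
  have hfin := hR.add (hslim.mul_const (fderiv ℝ (S.energy I) m z))
  rw [zero_add] at hfin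
  refine ge_of_tendsto' hfin fun k => ?_
  have h1 := (hN' k).1 (hwk k) _ _ (hp k)
  have h2 : S.energy I (b k) ≤ S.energy I m := by
    have := hm.le hE hI (hp k).2.1.le (hp k).2.2
    rwa [show s k • w + (p k - s k • (w + h k • z)) = b k by simp only [hb]; module] at this
  have h3 : p k - b k = (h k * s k) • z := by simp [hb]
  rw [add_sub_cancel_left, norm_smul, Real.norm_of_nonneg (hpos k).le] at h1
  simp only [Function.comp_apply, h3, map_smul, smul_eq_mul]
  rw [← sub_le_iff_le_add, le_div_iff₀ (hpos k)]
  nlinarith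

/-- Almost critical points of almost minimal energy in the Nehari-Pankov set. -/
theorem exists_almost_critical [CompleteSpace X] (hX : IsReflexiveSpace X) (hc : Continuous S.proj)
    (hplus : IsClosed (S.plus : Set X)) (hE : ContDiff ℝ 1 (S.energy I)) (hI : S.Conditions I)
    {c b : ℝ} (hcglb : IsGLB (S.energy I '' S.nehari I) c)
    (hb : 0 < b) (hbN : ∀ u ∈ S.nehari I, b ≤ ‖S.proj u‖) {ε : ℝ} (hε : 0 < ε) (hε' : ε ≤ 1 / 4) :
    ∃ u ∈ S.nehari I, S.energy I u ≤ c + ε ^ 2 ∧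
      ∀ z, |fderiv ℝ (S.energy I) u z| ≤ 2 / b * ε * ‖S.proj z‖ := by
  obtain ⟨_, ⟨u, hu, rfl⟩, -, hult⟩ :=
    hcglb.exists_between (show c < c + ε ^ 2 by linarith [pow_pos hε 2])
  -- Ekeland's principle needs a complete domain avoiding `0`. Starting on the unit sphere and
  -- moving by at most `ε ≤ 1 / 4` keeps `w` away from the boundary of `F`.
  let F : Set X := {w | w ∈ S.plus ∧ 1 / 2 ≤ ‖w‖}
  have hF : IsClosed F := hplus.inter (isClosed_le continuous_const continuous_norm)
  have : CompleteSpace F := hF.completeSpace_coe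
  have hF0 : ∀ {w : X}, 1 / 2 ≤ ‖w‖ → w ≠ 0 := by
    rintro w h rfl
    norm_num at h
  choose t m hm using fun w : F => exists_isFibrePoint hX hc hE hI w.2.1 (hF0 w.2.2)
  -- Near `w`, the fibrewise maximum dominates a continuous function that agrees with it at `w`.
  have hlsc : LowerSemicontinuous fun w : F => S.energy I (m w) := by
    intro w y hy
    have h1 : Continuous fun w' : F => S.energy I (t w • (w' : X) + (m w - t w • (w : X))) :=
      hE.continuous.comp (by fun_prop)
    have h2 := (h1.tendsto w).eventually_const_lt (u := y) (by rwa [add_sub_cancel])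
    filter_upwards [h2] with w' hw'
    exact hw'.trans_le ((hm w').le hE hI (hm w).2.1.le (hm w).2.2)
  have hlow : ∀ w : F, c ≤ S.energy I (m w) := fun w => hcglb.1 ⟨_, (hm w).1, rfl⟩
  have hupos : 0 < ‖S.proj u‖ := norm_pos_iff.2 (proj_ne_zero_of_mem_nehari hu)
  set w₀ : X := ‖S.proj u‖⁻¹ • S.proj u with hw₀
  have hw₀n : ‖w₀‖ = 1 := by
    rw [hw₀, norm_smul, norm_inv, norm_norm, inv_mul_cancel₀ hupos.ne']
  have hw₀F : w₀ ∈ F := ⟨S.plus.smul_mem _ (S.proj_mem u), by rw [hw₀n]; norm_num⟩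
  obtain ⟨⟨w, hwp, hwn⟩, hy1, hy2⟩ := exists_ekeland hlsc ⟨c, by rintro _ ⟨w, rfl⟩; exact hlow w⟩
    hε ⟨w₀, hw₀F⟩
  set wF : F := ⟨w, hwp, hwn⟩
  have hstart : S.energy I (m ⟨w₀, hw₀F⟩) ≤ S.energy I u := by
    have h1 := hm ⟨w₀, hw₀F⟩
    have h2 := (isFibrePoint_proj hu (inv_pos.2 hupos)).le hE hI h1.2.1.le h1.2.2
    rwa [add_sub_cancel] at h2
  have hdist : dist w₀ w ≤ ε := by
    change _ + ε * dist w₀ w ≤ _ at hy1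
    have := hlow wF
    have h3 : ε * dist w₀ w ≤ ε * ε := by nlinarith
    exact le_of_mul_le_mul_left h3 hε
  rw [dist_eq_norm] at hdist
  have hw1 : 3 / 4 ≤ ‖w‖ := by
    have := norm_sub_norm_le w₀ w
    linarith
  have hw2 : ‖w‖ ≤ 2 := by
    have := norm_sub_norm_le w w₀
    rw [norm_sub_rev] at this
    linarith
  have hmin : ∀ᶠ w' in 𝓝 w, w' ∈ S.plus → ∀ t' m', S.IsFibrePoint I w' t' m' →
      S.energy I (m wF) ≤ S.energy I m' + ε * ‖w' - w‖ := by
    have : ∀ᶠ w' in 𝓝 w, 1 / 2 < ‖w'‖ :=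
      (continuous_norm.tendsto w).eventually_const_lt (by linarith)
    filter_upwards [this] with w' hw' hw'p t' m' hm'
    have h1 := hy2 ⟨w', hw'p, hw'.le⟩
    have h2 := hm ⟨w', hw'p, hw'.le⟩
    have h3 := hm'.le hE hI h2.2.1.le h2.2.2
    rw [add_sub_cancel] at h3
    change _ ≤ _ + ε * dist w w' at h1
    rw [dist_eq_norm, norm_sub_rev] at h1
    linarith
  -- From `b ≤ t ‖w‖` and `‖w‖ ≤ 2`; this produces the constant `2 / b`.
  have ht : b / 2 ≤ t wF := by
    have h1 := hbN _ (hm wF).1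
    have h2 := (hm wF).2.1
    rw [(hm wF).proj_eq hwp, norm_smul, Real.norm_of_nonneg h2.le] at h1
    nlinarith
  have hder : ∀ z ∈ S.plus, -(2 / b * ε * ‖z‖) ≤ fderiv ℝ (S.energy I) (m wF) z := by
    intro z hz
    have h1 := neg_le_mul_fderiv hX hc hE hI hwp (hF0 hwn) (hm wF) hmin hz
    by_contra! hlt
    have h2 : t wF * fderiv ℝ (S.energy I) (m wF) z ≤
        b / 2 * fderiv ℝ (S.energy I) (m wF) z := by
      refine mul_le_mul_of_nonpos_right ht (hlt.le.trans ?_)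
      rw [neg_nonpos]; positivity
    have h3 := mul_lt_mul_of_pos_left hlt (half_pos hb)
    have h4 : b / 2 * -(2 / b * ε * ‖z‖) = -(ε * ‖z‖) := by field_simp
    linarith
  refine ⟨m wF, (hm wF).1, ?_, fun z => ?_⟩
  · have := mul_nonneg hε.le (dist_nonneg (x := (⟨w₀, hw₀F⟩ : F)) (y := wF))
    linarith
  · have h1 : fderiv ℝ (S.energy I) (m wF) z = fderiv ℝ (S.energy I) (m wF) (S.proj z) := by
      conv_lhs => rw [← S.proj_add_coproj z, map_add,
        (hm wF).1.2 _ (Submodule.mem_sup_right (S.coproj_mem z)), add_zero]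
    rw [h1, abs_le]
    refine ⟨hder _ (S.proj_mem z), ?_⟩
    have := hder _ (S.plus.neg_mem (S.proj_mem z))
    rw [map_neg, norm_neg] at this
    linarith

/-- A minimizing sequence in the Nehari-Pankov set along which the derivative of the energy tends
to zero. -/
theorem exists_palaisSmale_seq [CompleteSpace X] (hX : IsReflexiveSpace X) (hc : Continuous S.proj)
    (hplus : IsClosed (S.plus : Set X)) (hE : ContDiff ℝ 1 (S.energy I)) (hI : S.Conditions I)
    {c : ℝ} (hcglb : IsGLB (S.energy I '' S.nehari I) c) :
    ∃ u : ℕ → X, (∀ n, u n ∈ S.nehari I) ∧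
      Tendsto (fun n => S.energy I (u n)) atTop (𝓝 c) ∧
      ∀ z, Tendsto (fun n => fderiv ℝ (S.energy I) (u n) z) atTop (𝓝 0) := by
  obtain ⟨a, ha, hage⟩ := exists_pos_le_energy hE hI
  -- Since a ≤ J(u) ≤ ‖u⁺‖² / 2 on the Nehari–Pankov set.
  have hbN : ∀ u ∈ S.nehari I, √(2 * a) ≤ ‖S.proj u‖ := fun u hu => by
    rw [Real.sqrt_le_left (norm_nonneg _)]
    linarith [hage u hu, hI.energy_le u]
  have hlim : Tendsto (fun n : ℕ => 1 / 4 * (1 / ((n : ℝ) + 1))) atTop (𝓝 0) := by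
    have := (tendsto_one_div_add_atTop_nhds_zero_nat (𝕜 := ℝ)).const_mul (1 / 4)
    rwa [mul_zero] at this
  have hle : ∀ n : ℕ, 1 / 4 * (1 / ((n : ℝ) + 1)) ≤ 1 / 4 := fun n => by
    have : 1 / ((n : ℝ) + 1) ≤ 1 := by
      rw [div_le_one (by positivity)]
      linarith [n.cast_nonneg (α := ℝ)]
    linarith
  choose u hu huc hud using fun n : ℕ => exists_almost_critical hX hc hplus hE hI hcglb
    (Real.sqrt_pos.2 (by positivity)) hbN (ε := 1 / 4 * (1 / ((n : ℝ) + 1))) (by positivity) (hle n)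
  refine ⟨u, hu, ?_, fun z => ?_⟩
  · refine tendsto_of_tendsto_of_tendsto_of_le_of_le tendsto_const_nhds
      (by simpa using (hlim.pow 2).const_add c) (fun n => hcglb.1 ⟨_, hu n, rfl⟩) huc
  · refine squeeze_zero_norm (fun n => hud n z) ?_
    simpa using (hlim.const_mul (2 / √(2 * a))).mul_const ‖S.proj z‖

end Splitting
end NehariPankov

/-! ### Comparison of the two functionals -/

namespace NehariPankov

namespace TripleSplitting

variable {X : Type*} [NormedAddCommGroup X] [NormedSpace ℝ X] (T : TripleSplitting X)

/-- This gives both functionals the same fibres, so their maxima can be compared fibre by fibre. -/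
theorem cp_eq_main (hzero : T.zero = ⊥) : T.cp = T.main := by
  simp [cp, main, hzero]

theorem continuous_proj_main : Continuous T.main.proj := T.isTopCompl.continuous_projection

end TripleSplitting

namespace Splitting

variable {X : Type*} [NormedAddCommGroup X] [NormedSpace ℝ X] {S : Splitting X} {I Icp : X → ℝ}

/-- If the plus parts of a minimizing sequence in the Nehari-Pankov set of `I` tend weakly to zero,
then the infimum for the compactly perturbed functional is not larger than that for `I`. -/
theorem le_of_weakTendsto_zero (hX : IsReflexiveSpace X) (hc : Continuous S.proj)
    (hE : ContDiff ℝ 1 (S.energy I)) (hEcp : ContDiff ℝ 1 (S.energy Icp))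
    (hI : S.Conditions I) (hIcp : S.Conditions Icp)
    (hcoercp : CoerciveOn (S.energy Icp) (S.nehari Icp))
    (hdiff : ∀ u : ℕ → X, (∀ n, u n ∈ S.nehari Icp) → IsBounded (Set.range u) →
      WeakTendsto (fun n => S.proj (u n)) 0 →
      Tendsto (fun n => S.energy Icp (u n) - S.energy I (u n)) atTop (𝓝 0))
    {M : ℝ} (hMle : ∀ u ∈ S.nehari Icp,
      S.energy Icp u - S.energy I u ≤ M * ‖S.proj u‖ ^ 2)
    (hC2 : ∀ (t : ℕ → ℝ) (u : ℕ → X), Tendsto t atTop atTop →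
      (∀ s : ℝ, 1 < s → ∃ δ > 0, ∀ n, δ ≤ I (s • S.proj (u n))) →
      Tendsto (fun n => I (t n • u n) / t n ^ 2) atTop atTop)
    {u : ℕ → X} (hu : ∀ n, u n ∈ S.nehari I) {C : ℝ} (hC : ∀ n, ‖S.proj (u n)‖ ≤ C)
    {c d : ℝ} (hulim : Tendsto (fun n => S.energy I (u n)) atTop (𝓝 c))
    (hd : ∀ u ∈ S.nehari Icp, d ≤ S.energy Icp u)
    (hweak : WeakTendsto (fun n => S.proj (u n)) 0) : d ≤ c := by
  obtain ⟨a, ha, hage⟩ := exists_pos_le_energy hE hI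
  obtain ⟨a', ha', hage'⟩ := exists_pos_le_energy hEcp hIcp
  choose s m hm using fun n => exists_isFibrePoint hX hc hEcp hIcp (S.proj_mem (u n))
    (proj_ne_zero_of_mem_nehari (hu n))
  have hproj : ∀ n, S.proj (m n) = s n • S.proj (u n) := fun n =>
    (hm n).proj_eq (S.proj_mem _)
  have hfib : ∀ n, S.IsFibrePoint I (S.proj (u n)) 1 (u n) := fun n => by
    simpa using isFibrePoint_proj (hu n) one_pos
  have hmu : ∀ n, S.energy I (m n) ≤ S.energy I (u n) := fun n => by
    have := (hfib n).le hE hI (hm n).2.1.le (hm n).2.2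
    rwa [add_sub_cancel] at this
  have hsq : ∀ n, ‖S.proj (m n)‖ ^ 2 = s n ^ 2 * ‖S.proj (u n)‖ ^ 2 := fun n => by
    rw [hproj, norm_smul, mul_pow, Real.norm_eq_abs, sq_abs]
  have hCsq : ∀ n, ‖S.proj (u n)‖ ^ 2 ≤ C ^ 2 := fun n =>
    pow_le_pow_left₀ (norm_nonneg _) (hC n) 2
  -- If `s → ∞`, (C2) makes `I (m) / s²` unbounded, whereas (C1) and positivity of J_cp(m) give I(m)
  -- ≤ (1/2 + M) ‖m⁺‖², which is of order `s²`.
  have hsb : BddAbove (Set.range s) := by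
    by_contra hub
    obtain ⟨φ, hφ, hsφ⟩ := exists_strictMono_tendsto_atTop hub
    have hpos : ∀ n, 0 < s n := fun n => (hm n).2.1
    have hpr : ∀ n, S.proj ((s (φ n))⁻¹ • m (φ n)) = S.proj (u (φ n)) := fun n => by
      rw [S.proj_smul, hproj, smul_smul, inv_mul_cancel₀ (hpos _).ne', one_smul]
    have hB := hC2 (fun n => s (φ n)) (fun n => (s (φ n))⁻¹ • m (φ n)) hsφ (by
      intro r hr
      -- From J(r u⁺) ≤ J(u) ≤ ‖u⁺‖² / 2 one gets I(r u⁺) ≥ (r² - 1) ‖u⁺‖² / 2, and ‖u⁺‖² / 2 ≥ a.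
      refine ⟨(r ^ 2 - 1) * a, mul_pos (by nlinarith) ha, fun n => ?_⟩
      rw [hpr]
      have h1 := (hfib (φ n)).le hE hI (s := r) (by linarith) S.tilde.zero_mem
      rw [add_zero, energy, S.proj_smul, S.proj_of_mem (S.proj_mem _), norm_smul, mul_pow,
        Real.norm_eq_abs, sq_abs] at h1
      have h2 := hI.energy_le (u (φ n))
      have h3 := hage _ (hu (φ n))
      have h4 : (r ^ 2 - 1) * a ≤ (r ^ 2 - 1) * (1 / 2 * ‖S.proj (u (φ n))‖ ^ 2) :=
        mul_le_mul_of_nonneg_left (h3.trans h2) (by nlinarith)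
      linarith)
    obtain ⟨n, hn⟩ := (hB.eventually_gt_atTop ((1 / 2 + |M|) * C ^ 2)).exists
    have hp := hpos (φ n)
    rw [smul_smul, mul_inv_cancel₀ hp.ne', one_smul, lt_div_iff₀ (by positivity)] at hn
    have h1 := hMle _ (hm (φ n)).1
    have h2 := hage' _ (hm (φ n)).1
    rw [S.energy_add_self I] at hn
    have h3 : (1 / 2 + M) * ‖S.proj (m (φ n))‖ ^ 2 ≤ (1 / 2 + |M|) * C ^ 2 * s (φ n) ^ 2 := by
      rw [hsq, mul_assoc, mul_comm (C ^ 2)]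
      have := le_abs_self M
      have := hCsq (φ n)
      gcongr
    linarith
  obtain ⟨B, hB⟩ := hsb
  have hsB : ∀ n, |s n| ≤ B := fun n => by
    rw [abs_of_pos (hm n).2.1]; exact hB ⟨n, rfl⟩
  obtain ⟨K, hK⟩ := hulim.bddAbove_range
  -- The level bounds J_cp(m) ≤ J(u) + M ‖m⁺‖².
  obtain ⟨R, hR⟩ := hcoercp.exists_bound (K + |M| * (B ^ 2 * C ^ 2))
  have hbound : ∀ n, ‖m n‖ ≤ R := fun n => by
    refine hR _ (hm n).1 ?_
    have h1 := hMle _ (hm n).1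
    have h2 := hmu n
    have h3 : S.energy I (u n) ≤ K := hK ⟨n, rfl⟩
    have h4 : M * ‖S.proj (m n)‖ ^ 2 ≤ |M| * (B ^ 2 * C ^ 2) := by
      rw [hsq]
      have := le_abs_self M
      have := hCsq n
      have : s n ^ 2 ≤ B ^ 2 := sq_le_sq' (abs_le.1 (hsB n)).1 (abs_le.1 (hsB n)).2
      gcongr
    linarith
  have hmw : WeakTendsto (fun n => S.proj (m n)) 0 := fun f => by
    simp only [hproj, map_smul, smul_eq_mul, map_zero]
    have hf := hweak f
    rw [map_zero] at hf
    refine bdd_le_mul_tendsto_zero' B (Eventually.of_forall hsB) hf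
  have hlim := hdiff m (fun n => (hm n).1)
    (isBounded_iff_forall_norm_le.2 ⟨R, by rintro _ ⟨n, rfl⟩; exact hbound n⟩) hmw
  have hsum := hlim.add hulim
  rw [zero_add] at hsum
  refine ge_of_tendsto' hsum fun n => ?_
  linarith [hd _ (hm n).1, hmu n]

end Splitting
end NehariPankov

/-! ### The strict inequality and the minimizer -/

open NehariPankov NehariPankov.Splitting in
theorem corollary3p3 {X : Type*} [NormedAddCommGroup X] [NormedSpace ℝ X] [CompleteSpace X]
    (hX : NehariPankov.IsReflexiveSpace X) (T : NehariPankov.TripleSplitting X)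
    (I Icp : X → ℝ)
    (hJ : ContDiff ℝ 1 (T.J I)) (hJcp : ContDiff ℝ 1 (T.Jcp Icp))
    (hI : T.main.Conditions I) (hIcp : T.cp.Conditions Icp)
    (hcoer : NehariPankov.CoerciveOn (T.J I) (T.N I))
    (hcoercp : NehariPankov.CoerciveOn (T.Jcp Icp) (T.Ncp Icp))
    (hC1 : T.C1 I Icp) (hC2 : T.C2 I) (hC3 : T.C3 I)
    (hzero : T.zero = ⊥)
    (hd : ∃ u ∈ T.Ncp Icp, fderiv ℝ (T.Jcp Icp) u = 0 ∧
      (T.Jcp Icp u : EReal) = NehariPankov.infOn (T.Jcp Icp) (T.Ncp Icp))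
    (hlt : ∀ u ∈ T.N I, T.J I u < T.Jcp Icp u) :
    NehariPankov.infOn (T.J I) (T.N I) < NehariPankov.infOn (T.Jcp Icp) (T.Ncp Icp) ∧
      ∃ u ∈ T.N I, fderiv ℝ (T.J I) u = 0 ∧
        (T.J I u : EReal) = NehariPankov.infOn (T.J I) (T.N I) := by
  simp only [TripleSplitting.J, TripleSplitting.N, TripleSplitting.Jcp, TripleSplitting.Ncp,
    TripleSplitting.C1, TripleSplitting.C2, TripleSplitting.C3, T.cp_eq_main hzero] at *
  have hc := T.continuous_proj_main
  have hplus : IsClosed (T.main.plus : Set X) := T.isHilbert_plus.1.isClosed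
  generalize T.main = S at *
  obtain ⟨u₀, hu₀, -, hdinf⟩ := hd
  obtain ⟨a, ha, hage⟩ := exists_pos_le_energy hJ hI
  -- `m` is the point of N on the fibre of the minimizer `u₀` of J_cp; it witnesses c < d.
  obtain ⟨t, m, hm⟩ := exists_isFibrePoint hX hc hJ hI (S.proj_mem u₀)
    (proj_ne_zero_of_mem_nehari hu₀)
  have hglb : IsGLB (S.energy I '' S.nehari I) (sInf (S.energy I '' S.nehari I)) :=
    isGLB_csInf ⟨_, m, hm.1, rfl⟩ ⟨a, by rintro _ ⟨u, hu, rfl⟩; exact hage u hu⟩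
  set c := sInf (S.energy I '' S.nehari I)
  have hmd : S.energy Icp m ≤ S.energy Icp u₀ := by
    have := (isFibrePoint_proj hu₀ one_pos).le hJcp hIcp hm.2.1.le (v := m - t • S.proj u₀) hm.2.2
    rwa [one_smul, add_sub_cancel] at this
  have hcd : c < S.energy Icp u₀ := (hglb.1 ⟨m, hm.1, rfl⟩).trans_lt ((hlt m hm.1).trans_le hmd)
  rw [infOn_eq_coe hglb, ← hdinf]
  refine ⟨EReal.coe_lt_coe_iff.2 hcd, ?_⟩
  have hdle : ∀ u ∈ S.nehari Icp, S.energy Icp u₀ ≤ S.energy Icp u := fun u hu => by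
    rw [← EReal.coe_le_coe_iff, hdinf]
    exact iInf₂_le u hu
  obtain ⟨u, hu, hulim, hder⟩ := exists_palaisSmale_seq hX hc hplus hJ hI hglb
  obtain ⟨K, hK⟩ := hulim.bddAbove_range
  obtain ⟨R, hR⟩ := hcoer.exists_bound K
  obtain ⟨φ, hφ, x, hx⟩ := exists_weakTendsto_subseq hX (x := u) fun n => hR _ (hu n) (hK ⟨n, rfl⟩)
  have hφlim := hφ.tendsto_atTop
  have hcrit : fderiv ℝ (S.energy I) x = 0 := by
    ext z
    exact tendsto_nhds_unique (hC3.1 _ x (fun n => hu (φ n)) hx z) ((hder z).comp hφlim)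
  -- Vanishing of the weak limit's plus part would force d ≤ c.
  have hxt : x ∉ S.tilde := by
    intro hxt
    obtain ⟨hdiff, M, -, hM⟩ := hC1
    have hweak := S.proj_weakTendsto hc hx
    rw [S.proj_eq_zero_iff.2 hxt] at hweak
    obtain ⟨C, hC⟩ : ∃ C, ∀ n, ‖S.proj (u (φ n))‖ ≤ C :=
      ⟨‖S.projL hc‖ * R, fun n => (S.projL hc).le_opNorm_of_le (hR _ (hu _) (hK ⟨_, rfl⟩))⟩
    exact absurd (le_of_weakTendsto_zero hX hc hJ hJcp hI hIcp hcoercp hdiff hM hC2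
      (fun n => hu (φ n)) hC (hulim.comp hφlim) hdle hweak) (not_le.2 hcd)
  have hxN : x ∈ S.nehari I := ⟨hxt, fun w _ => by rw [hcrit]; rfl⟩
  refine ⟨x, hxN, hcrit, le_antisymm ?_ (EReal.coe_le_coe_iff.2 (hglb.1 ⟨x, hxN, rfl⟩))⟩
  have h := hC3.2 _ x (fun n => hu (φ n)) hx hxN
  exact h.trans_eq (EReal.tendsto_coe.2 (hulim.comp hφlim)).liminf_eq
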